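/- Let $M$ be a complex manifold of complex dimension $n\ge 1$ with complex structure $J$ and a smooth Hermitian metric $h$, written $h=h_{\alpha\bar\beta}\,dz^\alpha d\bar z^\beta$ in local holomorphic coordinates, and let $g=\operatorname{Re}h$. Let $D$ be the Chern connection, with coefficients $\Gamma^{\alpha}_{\beta;\gamma}=h^{\bar\lambda\alpha}\,\partial h_{\beta\bar\lambda}/\partial z^\gamma$ and curvature tensor $$\mathfrak K_{\alpha\bar\beta\gamma\bar\delta}=-\frac{\partial^2h_{\alpha\bar\beta}}{\partial z^\gamma\partial\bar z^\delta}+\frac{\partial h_{\alpha\bar\lambda}}{\partial z^\gamma}\,h^{\bar\lambda\kappa}\,\frac{\partial h_{\kappa\bar\beta}}{\partial\bar z^\delta}.$$ For nonzero $\xi,\eta\in T^{1,0}_pM$ let $$B(\xi,\eta)=\frac{\mathfrak K(\xi,\bar\xi,\eta,\bar\eta)}{h(\xi,\xi)\,h(\eta,\eta)},\qquad H(\xi)=B(\xi,\xi)$$ be the holomorphic bisectional and the holomorphic sectional curvature (both are real). Write $D$ also for the $g$-metric connection on the real tangent bundle $TM$ induced by the Chern connection through the isomorphism $u\mapsto\frac12(u-\sqrt{-1}\,Ju)$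 of $TM$ with $T^{1,0}M$, let $(D^2w)(u,v)=D_uD_vw-D_vD_uw-D_{[u,v]}w$ be its curvature, and for linearly independent $u,v\in T_pM$ let $$K_D(u,v)=\frac{g\big((D^2u)(v,u),v\big)}{g(u,u)\,g(v,v)-g(u,v)^2}$$ be the Chern sectional curvature. Suppose that $h$ is Kähler-like, that is, $\mathfrak K_{\alpha\bar\beta\gamma\bar\delta}=\mathfrak K_{\gamma\bar\beta\alpha\bar\delta}$ for all indices, at every point. **Theorem 1.4.** (a) If $K_D(u,v)\ge 0$ for all $p\in M$ and all linearly independent $u,v\in T_pM$, then for every $p\in M$ there is a nonzero $\zeta\in T^{1,0}_pM$ with $$B(\xi,\eta)\le H(\zeta)\qquad\text{for all nonzero }\xi,\eta\in T^{1,0}_pM,$$ so at each point the maximum of $B$ exists and is the maximum of the holomorphic sectional curvature. Moreover, a real number $C$ is the maximum of $H$ over all points of $M$ and all nonzero vectors if and only if it is the maximum of $B$ over all points of $M$ and all pairs of nonzero vectors. (b) If $K_D(u,v)\le 0$ for all $p\in M$ and all linearly independent $u,v\in T_pM$, then for every $p\in M$ there is a nonzero $\zeta\in T^{1,0}_pM$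 with $$B(\xi,\eta)\ge H(\zeta)\qquad\text{for all nonzero }\xi,\eta\in T^{1,0}_pM,$$ and a real number $C$ is the minimum of $H$ over all points of $M$ and all nonzero vectors if and only if it is the minimum of $B$ over all points of $M$ and all pairs of nonzero vectors. -/

import Mathlib

open scoped Manifold ContDiff ComplexConjugate

noncomputable section

namespace HermitianGeometry

variable {n : ℕ}

/-! ### Local theory on `ℂⁿ` -/

/-- The local model `ℂⁿ`. -/
abbrev Cn (n : ℕ) := EuclideanSpace ℂ (Fin n)

/-- The coordinate vector `∂/∂z^α`. -/
def cvec (α : Fin n) : Cn n := EuclideanSpace.single α (1 : ℂ)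

/-- The Wirtinger derivative `∂f/∂z^γ = ½ (∂f/∂x^γ - i ∂f/∂y^γ)`. -/
def dz (γ : Fin n) (f : Cn n → ℂ) (z : Cn n) : ℂ :=
  (1 / 2) * (fderiv ℝ f z (cvec γ) - Complex.I * fderiv ℝ f z (Complex.I • cvec γ))

/-- The Wirtinger derivative `∂f/∂z̄^δ = ½ (∂f/∂x^δ + i ∂f/∂y^δ)`. -/
def dzbar (δ : Fin n) (f : Cn n → ℂ) (z : Cn n) : ℂ :=
  (1 / 2) * (fderiv ℝ f z (cvec δ) + Complex.I * fderiv ℝ f z (Complex.I • cvec δ))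

/-- The components `𝔎_{α β̄ γ δ̄}` of the Chern curvature tensor of the local metric
`G α β = h_{α β̄}`:
`- ∂²h_{αβ̄}/∂z^γ∂z̄^δ + (∂h_{αλ̄}/∂z^γ) h^{λ̄κ} (∂h_{κβ̄}/∂z̄^δ)`. -/
def chernCurvature (G : Cn n → Matrix (Fin n) (Fin n) ℂ) (z : Cn n) (α β γ δ : Fin n) : ℂ :=
  -dz γ (dzbar δ fun w => G w α β) z
    + ∑ l, ∑ k, dz γ (fun w => G w α l) z * (G z)⁻¹ l k * dzbar δ (fun w => G w k β) z

/-- The Chern connection coefficients `Γ^α_{β;γ} = h^{λ̄α} ∂h_{βλ̄}/∂z^γ`. -/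
def chernCoeff (G : Cn n → Matrix (Fin n) (Fin n) ℂ) (z : Cn n) (α β γ : Fin n) : ℂ :=
  ∑ l, (G z)⁻¹ l α * dz γ (fun w => G w β l) z

/-- The connection on the real tangent bundle induced by the Chern connection through the
isomorphism `u ↦ ½ (u - i J u)` onto `T^{1,0}`, acting on real vector fields.  A real tangent
vector `u` is recorded by the components `ξ^α = u^α + i u^{n+α}` of `u_o`; in these components
`(D_X V)^α = X(V^α) + Γ^α_{β;γ} V^β X^γ`. -/
def inducedConnection (G : Cn n → Matrix (Fin n) (Fin n) ℂ) (X V : Cn n → Cn n) (z : Cn n) :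
    Cn n :=
  fderiv ℝ V z (X z)
    + WithLp.toLp 2 fun α => ∑ β, ∑ γ, chernCoeff G z α β γ * V z β * X z γ

/-- The curvature `(D²V)(X,Y) = D_X D_Y V - D_Y D_X V - D_{[X,Y]} V` of the induced
connection. -/
def inducedCurvature (G : Cn n → Matrix (Fin n) (Fin n) ℂ) (X Y V : Cn n → Cn n) (z : Cn n) :
    Cn n :=
  inducedConnection G X (inducedConnection G Y V) z
    - inducedConnection G Y (inducedConnection G X V) z
    - inducedConnection G (VectorField.lieBracket ℝ X Y) V z

/-! ### Hermitian manifolds -/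

variable {M : Type*} [TopologicalSpace M] [ChartedSpace (Cn n) M]

/-- The tangent space at `p` of a complex manifold modelled on `ℂⁿ`.  Its underlying real vector
space is the real tangent space `T_pM`, multiplication by `i` is `J`, and the complex vector
space `(T_pM, J)` is identified with `T^{1,0}_pM` through `u ↦ u_o = ½ (u - i J u)`.  Its
elements are given by their components in the preferred chart at `p`. -/
abbrev Tan (p : M) := TangentSpace 𝓘(ℂ, Cn n) p

variable [IsManifold 𝓘(ℂ, Cn n) 1 M]

/-- The coordinate frame `∂/∂z^α` of the preferred chart at `p`, at the point `q` with coordinates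
`z` in that chart: its components in the preferred chart at `q` are the `α`-th column of the
Jacobian of the change of coordinates from the chart at `p` to the chart at `q`. -/
def frame (p : M) (z : Cn n) (α : Fin n) : Tan (n := n) ((extChartAt 𝓘(ℂ, Cn n) p).symm z) :=
  tangentCoordChange 𝓘(ℂ, Cn n) p ((extChartAt 𝓘(ℂ, Cn n) p).symm z)
    ((extChartAt 𝓘(ℂ, Cn n) p).symm z) (cvec α)

variable (n M) in
/-- A (smooth) Hermitian metric on the complex manifold `M`: a positive definite Hermitian form
on each tangent space, linear in the first and conjugate-linear in the second argument, whose
components in the charts are smooth in the real sense. -/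
structure HermitianMetric where
  /-- The Hermitian form on the tangent space at `p`. -/
  form (p : M) : Tan (n := n) p →ₗ[ℂ] Tan (n := n) p →ₗ⋆[ℂ] ℂ
  conj_symm (p : M) (ξ η : Tan (n := n) p) : conj (form p ξ η) = form p η ξ
  pos (p : M) (ξ : Tan (n := n) p) : ξ ≠ 0 → 0 < (form p ξ ξ).re
  smooth (p : M) (α β : Fin n) :
    ContDiffOn ℝ ∞
      (fun z => form ((extChartAt 𝓘(ℂ, Cn n) p).symm z) (frame p z α) (frame p z β))
      (extChartAt 𝓘(ℂ, Cn n) p).target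

namespace HermitianMetric

variable (h : HermitianMetric n M)

/-- The local components `h_{αβ̄}(z) = h(∂/∂z^α, ∂/∂z^β)` in the preferred chart at `p`. -/
def comp (p : M) (z : Cn n) : Matrix (Fin n) (Fin n) ℂ :=
  Matrix.of fun α β =>
    h.form ((extChartAt 𝓘(ℂ, Cn n) p).symm z) (frame p z α) (frame p z β)

/-- The components `𝔎_{α β̄ γ δ̄}` of the Chern curvature tensor at `p`. -/
def curv (p : M) (α β γ δ : Fin n) : ℂ :=
  chernCurvature (h.comp p) (extChartAt 𝓘(ℂ, Cn n) p p) α β γ δ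

/-- The metric is Kähler-like: `𝔎_{α β̄ γ δ̄} = 𝔎_{γ β̄ α δ̄}`. -/
def IsKahlerLike : Prop :=
  ∀ (p : M) (α β γ δ : Fin n), h.curv p α β γ δ = h.curv p γ β α δ

/-- `𝔎(ξ, ξ̄, η, η̄)` at `p`. -/
def curvForm (p : M) (ξ η : Cn n) : ℂ :=
  ∑ α, ∑ β, ∑ γ, ∑ δ, h.curv p α β γ δ * ξ α * conj (ξ β) * η γ * conj (η δ)

/-- The holomorphic bisectional curvature `B(ξ,η) = 𝔎(ξ,ξ̄,η,η̄) / (h(ξ,ξ) h(η,η))`, for nonzero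
`ξ`, `η`.  The quotient is a real number; it is read as an element of `ℝ` by taking the real
part. -/
def bisectional (p : M) (ξ η : Tan (n := n) p) : ℝ :=
  (h.curvForm p ξ η / (h.form p ξ ξ * h.form p η η)).re

/-- The holomorphic sectional curvature `H(ξ) = B(ξ,ξ)`, for nonzero `ξ`. -/
def holomorphicSectional (p : M) (ξ : Tan (n := n) p) : ℝ := h.bisectional p ξ ξ

/-- The background Riemannian metric `g = Re h`. -/
def g (p : M) (u v : Tan (n := n) p) : ℝ := (h.form p u v).re

/-- `(D²w)(u,v)` at `p`, for the metric connection `D` on the real tangent bundle induced by the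
Chern connection; it is tensorial in `u`, `v`, `w`, which are extended with constant components in
the preferred chart at `p`. -/
def curvatureD (p : M) (u v w : Tan (n := n) p) : Tan (n := n) p :=
  inducedCurvature (h.comp p) (fun _ => u) (fun _ => v) (fun _ => w) (extChartAt 𝓘(ℂ, Cn n) p p)

/-- The Chern sectional curvature
`K_D(u,v) = g((D²u)(v,u), v) / (g(u,u) g(v,v) - g(u,v)²)` of the real plane spanned by linearly
independent `u`, `v`. -/
def chernSectional (p : M) (u v : Tan (n := n) p) : ℝ :=
  h.g p (h.curvatureD p v u u) v / (h.g p u u * h.g p v v - h.g p u v ^ 2)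

end HermitianMetric

end HermitianGeometry

end

noncomputable section

namespace HermitianGeometry

variable {n : ℕ}

/-! ### Algebraic curvature tensors and Hermitian forms on `ℂⁿ` -/

/-! Everything happens at one point. Write `Q(u,v) = 𝔎(u,ū,v,v̄)` and `F(u) = Q(u,u)`. A Kähler-like
metric has a curvature tensor symmetric in the unbarred slots, hence by conjugation in the barred
ones. The numerator of `K_D(u,v)` is then `Q(u,v) - Re 𝔎(u,v̄,u,v̄)` (`hermSum_inducedCurvature`,
`g_curvatureD`). Replacing `v` by `iv` keeps `Q` and reverses the other term, so adding the two
inequalities gives `Q` the sign of `K_D` (`tensorForm_sign`).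

The polarization `quartic_add_quartic`, `F(ξ+iη) + F(ξ-iη) = 2Q(ξ+η,ξ-η) + 8Q(ξ,η)`, finishes the
argument. Scale `ξ`, `η` to be unit with `h(ξ,η)` real; then `ξ ± iη` both have squared norm 2, and
for `Q ≥ 0` the identity reads `H(ξ+iη) + H(ξ-iη) ≥ 2B(ξ,η)`. One of the two holomorphic values thus
dominates `B(ξ,η)`, and `H` attains its maximum on the compact unit sphere. A real factor `σ`, taken
as `1` or `-1`, treats both signs at once. -/

/-- The sesquilinear form `∑ A α β ξ^α η̄^β` of a matrix. -/
def hermSum (A : Matrix (Fin n) (Fin n) ℂ) (ξ η : Cn n) : ℂ :=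
  ∑ α, ∑ β, A α β * ξ α * conj (η β)

/-- The form `∑ k α β γ δ a^α b̄^β c^γ d̄^δ` of a tensor of type `(2,2)`. -/
def tensorForm (k : Fin n → Fin n → Fin n → Fin n → ℂ) (a b c d : Cn n) : ℂ :=
  ∑ α, ∑ β, ∑ γ, ∑ δ, k α β γ δ * a α * conj (b β) * c γ * conj (d δ)

section hermSum

variable (A : Matrix (Fin n) (Fin n) ℂ)

lemma hermSum_add_left (a b c : Cn n) : hermSum A (a + b) c = hermSum A a c + hermSum A b c := by
  simp only [hermSum, ← Finset.sum_add_distrib, PiLp.add_apply]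
  refine Finset.sum_congr rfl fun _ _ => Finset.sum_congr rfl fun _ _ => by ring

lemma hermSum_add_right (a b c : Cn n) : hermSum A a (b + c) = hermSum A a b + hermSum A a c := by
  simp only [hermSum, ← Finset.sum_add_distrib, PiLp.add_apply, map_add]
  refine Finset.sum_congr rfl fun _ _ => Finset.sum_congr rfl fun _ _ => by ring

lemma hermSum_smul_left (t : ℂ) (a b : Cn n) : hermSum A (t • a) b = t * hermSum A a b := by
  simp only [hermSum, Finset.mul_sum, PiLp.smul_apply, smul_eq_mul]
  refine Finset.sum_congr rfl fun _ _ => Finset.sum_congr rfl fun _ _ => by ring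

lemma hermSum_smul_right (t : ℂ) (a b : Cn n) : hermSum A a (t • b) = conj t * hermSum A a b := by
  simp only [hermSum, Finset.mul_sum, PiLp.smul_apply, smul_eq_mul, map_mul]
  refine Finset.sum_congr rfl fun _ _ => Finset.sum_congr rfl fun _ _ => by ring

variable {A} in
lemma conj_hermSum (hA : ∀ α β, conj (A α β) = A β α) (a b : Cn n) :
    conj (hermSum A a b) = hermSum A b a := by
  simp only [hermSum, map_sum, map_mul, hA, Complex.conj_conj]
  rw [Finset.sum_comm]
  refine Finset.sum_congr rfl fun _ _ => Finset.sum_congr rfl fun _ _ => by ring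

end hermSum

section tensorForm

variable (k : Fin n → Fin n → Fin n → Fin n → ℂ)

lemma tensorForm_add₁ (a a' b c d : Cn n) :
    tensorForm k (a + a') b c d = tensorForm k a b c d + tensorForm k a' b c d := by
  simp only [tensorForm, ← Finset.sum_add_distrib, PiLp.add_apply]
  refine Finset.sum_congr rfl fun _ _ => Finset.sum_congr rfl fun _ _ =>
    Finset.sum_congr rfl fun _ _ => Finset.sum_congr rfl fun _ _ => by ring

lemma tensorForm_add₂ (a b b' c d : Cn n) :
    tensorForm k a (b + b') c d = tensorForm k a b c d + tensorForm k a b' c d := by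
  simp only [tensorForm, ← Finset.sum_add_distrib, PiLp.add_apply, map_add]
  refine Finset.sum_congr rfl fun _ _ => Finset.sum_congr rfl fun _ _ =>
    Finset.sum_congr rfl fun _ _ => Finset.sum_congr rfl fun _ _ => by ring

lemma tensorForm_smul₁ (t : ℂ) (a b c d : Cn n) :
    tensorForm k (t • a) b c d = t * tensorForm k a b c d := by
  simp only [tensorForm, Finset.mul_sum, PiLp.smul_apply, smul_eq_mul]
  refine Finset.sum_congr rfl fun _ _ => Finset.sum_congr rfl fun _ _ =>
    Finset.sum_congr rfl fun _ _ => Finset.sum_congr rfl fun _ _ => by ring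

lemma tensorForm_smul₂ (t : ℂ) (a b c d : Cn n) :
    tensorForm k a (t • b) c d = conj t * tensorForm k a b c d := by
  simp only [tensorForm, Finset.mul_sum, PiLp.smul_apply, smul_eq_mul, map_mul]
  refine Finset.sum_congr rfl fun _ _ => Finset.sum_congr rfl fun _ _ =>
    Finset.sum_congr rfl fun _ _ => Finset.sum_congr rfl fun _ _ => by ring

variable {k}

lemma tensorForm_swap (hk : ∀ α β γ δ, k α β γ δ = k γ β α δ) (a b c d : Cn n) :
    tensorForm k a b c d = tensorForm k c b a d := by
  unfold tensorForm
  calc _ = ∑ β, ∑ γ, ∑ α, ∑ δ, k α β γ δ * a α * conj (b β) * c γ * conj (d δ) := by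
        rw [Finset.sum_comm]
        exact Finset.sum_congr rfl fun _ _ => Finset.sum_comm
    _ = _ := by
        rw [Finset.sum_comm]
        refine Finset.sum_congr rfl fun γ _ => Finset.sum_congr rfl fun β _ =>
          Finset.sum_congr rfl fun α _ => Finset.sum_congr rfl fun δ _ => ?_
        rw [hk]; ring

lemma conj_tensorForm (hk : ∀ α β γ δ, conj (k α β γ δ) = k β α δ γ) (a b c d : Cn n) :
    conj (tensorForm k a b c d) = tensorForm k b a d c := by
  simp only [tensorForm, map_sum, map_mul, hk, Complex.conj_conj]
  rw [Finset.sum_comm]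
  refine Finset.sum_congr rfl fun _ _ => Finset.sum_congr rfl fun _ _ => ?_
  rw [Finset.sum_comm]
  refine Finset.sum_congr rfl fun _ _ => Finset.sum_congr rfl fun _ _ => by ring

/-- A tensor with the symmetries of the curvature tensor of a Kähler metric. -/
structure IsKahlerTensor (k : Fin n → Fin n → Fin n → Fin n → ℂ) : Prop where
  swap : ∀ α β γ δ, k α β γ δ = k γ β α δ
  conj_eq : ∀ α β γ δ, conj (k α β γ δ) = k β α δ γ

/-- Conjugation exchanges barred and unbarred slots, so it carries one symmetry to the other. The
linearity rules for the last two slots then follow from those for the first two. -/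
lemma IsKahlerTensor.tensorForm_swap' (hk : IsKahlerTensor k) (a b c d : Cn n) :
    tensorForm k a b c d = tensorForm k a d c b := by
  rw [← conj_tensorForm hk.conj_eq, tensorForm_swap hk.swap, conj_tensorForm hk.conj_eq]

lemma IsKahlerTensor.tensorForm_add₃ (hk : IsKahlerTensor k) (a b c c' d : Cn n) :
    tensorForm k a b (c + c') d = tensorForm k a b c d + tensorForm k a b c' d := by
  simp only [tensorForm_swap hk.swap a, tensorForm_add₁]

lemma IsKahlerTensor.tensorForm_add₄ (hk : IsKahlerTensor k) (a b c d d' : Cn n) :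
    tensorForm k a b c (d + d') = tensorForm k a b c d + tensorForm k a b c d' := by
  simp only [hk.tensorForm_swap' a b, tensorForm_add₂]

lemma IsKahlerTensor.tensorForm_smul₃ (hk : IsKahlerTensor k) (t : ℂ) (a b c d : Cn n) :
    tensorForm k a b (t • c) d = t * tensorForm k a b c d := by
  simp only [tensorForm_swap hk.swap a, tensorForm_smul₁]

lemma IsKahlerTensor.tensorForm_smul₄ (hk : IsKahlerTensor k) (t : ℂ) (a b c d : Cn n) :
    tensorForm k a b c (t • d) = conj t * tensorForm k a b c d := by
  simp only [hk.tensorForm_swap' a b, tensorForm_smul₂]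

/-- `F(ξ + iη) + F(ξ - iη) = 2 Q(ξ + η, ξ - η) + 8 Q(ξ, η)` for the quartic form `F` and the
biquadratic form `Q` of a Kähler curvature tensor. -/
lemma IsKahlerTensor.quartic_add_quartic (hk : IsKahlerTensor k) (ξ η : Cn n) :
    tensorForm k (ξ + Complex.I • η) (ξ + Complex.I • η) (ξ + Complex.I • η) (ξ + Complex.I • η)
      + tensorForm k (ξ + (-Complex.I) • η) (ξ + (-Complex.I) • η) (ξ + (-Complex.I) • η)
          (ξ + (-Complex.I) • η)
      = 2 * tensorForm k (ξ + η) (ξ + η) (ξ + (-1 : ℂ) • η) (ξ + (-1 : ℂ) • η)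
        + 8 * tensorForm k ξ ξ η η := by
  -- By both symmetries the form is a sesquilinear pairing on symmetric squares. There `(ξ ± iη)² =
  -- ξ² ± 2iξη - η²` and `(ξ+η)(ξ-η) = ξ² - η²`; the cross terms `±2iξη`, paired with themselves,
  -- give `4Q(ξ,η)` for each sign.
  have h₁ : ∀ b d, tensorForm k η b ξ d = tensorForm k ξ b η d := fun b d =>
    tensorForm_swap hk.swap _ _ _ _
  have h₂ : ∀ a c, tensorForm k a η c ξ = tensorForm k a ξ c η := fun a c =>
    hk.tensorForm_swap' _ _ _ _
  simp only [tensorForm_add₁, tensorForm_add₂, hk.tensorForm_add₃, hk.tensorForm_add₄,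
    tensorForm_smul₁, tensorForm_smul₂, hk.tensorForm_smul₃, hk.tensorForm_smul₄, h₁, h₂,
    Complex.conj_I, map_neg, map_one]
  linear_combination (2 * tensorForm k η η η η * (Complex.I ^ 2 - 1)
    - 8 * tensorForm k ξ ξ η η + 2 * tensorForm k ξ η ξ η + 2 * tensorForm k η ξ η ξ)
    * Complex.I_sq

/-! ### Bisectional values dominated by holomorphic sectional values -/

/-- The quotient of the biquadratic form of `k` by the Hermitian form of `A`. -/
def bisecQuot (k : Fin n → Fin n → Fin n → Fin n → ℂ) (A : Matrix (Fin n) (Fin n) ℂ)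
    (ξ η : Cn n) : ℝ :=
  (tensorForm k ξ ξ η η / (hermSum A ξ ξ * hermSum A η η)).re

variable {A : Matrix (Fin n) (Fin n) ℂ}

lemma IsKahlerTensor.bisecQuot_smul (hk : IsKahlerTensor k) {s t : ℂ} (hs : s ≠ 0) (ht : t ≠ 0)
    (ξ η : Cn n) : bisecQuot k A (s • ξ) (t • η) = bisecQuot k A ξ η := by
  unfold bisecQuot
  congr 1
  simp only [tensorForm_smul₁, tensorForm_smul₂, hk.tensorForm_smul₃, hk.tensorForm_smul₄,
    hermSum_smul_left, hermSum_smul_right]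
  have hs' : conj s ≠ 0 := (map_ne_zero _).2 hs
  have ht' : conj t ≠ 0 := (map_ne_zero _).2 ht
  rw [← mul_div_mul_left (tensorForm k ξ ξ η η) _
    (mul_ne_zero (mul_ne_zero hs hs') (mul_ne_zero ht ht'))]
  congr 1 <;> ring

/-- Reality of the product makes the cross terms of `h(ξ ± iη, ξ ± iη)` cancel. Complex rescaling is
harmless because `bisecQuot` is invariant under it. -/
lemma exists_smul_unit_real (hA : ∀ α β, conj (A α β) = A β α)
    (hpos : ∀ ξ : Cn n, ξ ≠ 0 → 0 < (hermSum A ξ ξ).re) {ξ η : Cn n} (hξ : ξ ≠ 0) (hη : η ≠ 0) :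
    ∃ s t : ℂ, s ≠ 0 ∧ t ≠ 0 ∧ hermSum A (s • ξ) (s • ξ) = 1 ∧ hermSum A (t • η) (t • η) = 1 ∧
      hermSum A (t • η) (s • ξ) = hermSum A (s • ξ) (t • η) := by
  have hre : ∀ ξ, hermSum A ξ ξ = ((hermSum A ξ ξ).re : ℂ) := fun ξ =>
    (Complex.conj_eq_iff_re.1 (conj_hermSum hA ξ ξ)).symm
  have hunit : ∀ ξ : Cn n, ξ ≠ 0 → ∃ s : ℝ, 0 < s ∧ ((s : ℂ) * s) * hermSum A ξ ξ = 1 := by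
    intro ξ hξ
    have h0 := hpos ξ hξ
    refine ⟨(√(hermSum A ξ ξ).re)⁻¹, by positivity, ?_⟩
    rw [hre ξ, ← Complex.ofReal_mul, ← Complex.ofReal_mul, ← mul_inv,
      Complex.ofReal_re, Real.mul_self_sqrt h0.le, inv_mul_cancel₀ h0.ne', Complex.ofReal_one]
  obtain ⟨s, hs, hs1⟩ := hunit ξ hξ
  obtain ⟨t, ht, ht1⟩ := hunit η hη
  -- `w` is the phase of `h(ξ,η)`, so that `w̄ h(ξ,η)` is its modulus; any phase serves when the
  -- product vanishes.
  obtain ⟨w, hw, hw1⟩ : ∃ w : ℂ, w * conj w = 1 ∧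
      w * conj (hermSum A ξ η) = conj w * hermSum A ξ η := by
    by_cases hc : hermSum A ξ η = 0
    · exact ⟨1, by simp, by simp [hc]⟩
    · have hn : ((‖hermSum A ξ η‖ : ℝ) : ℂ) ≠ 0 := by simpa using hc
      have hm := Complex.mul_conj' (hermSum A ξ η)
      refine ⟨hermSum A ξ η / ‖hermSum A ξ η‖, ?_, ?_⟩
      · rw [map_div₀, Complex.conj_ofReal]
        field_simp
        exact hm
      · rw [map_div₀, Complex.conj_ofReal]
        ring
  have hw0 : w ≠ 0 := by rintro rfl; simp at hw
  refine ⟨s, w * t, by exact_mod_cast hs.ne', mul_ne_zero hw0 (by exact_mod_cast ht.ne'), ?_⟩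
  simp only [hermSum_smul_left, hermSum_smul_right, map_mul, Complex.conj_ofReal]
  rw [← conj_hermSum hA ξ η]
  refine ⟨by linear_combination hs1, by linear_combination hw * (t * t * hermSum A η η) + ht1, ?_⟩
  linear_combination (s * t : ℂ) * hw1

/-- If the biquadratic form has the sign of `σ`, then each bisectional value is dominated by a
holomorphic sectional value. -/
lemma IsKahlerTensor.exists_bisecQuot_le (hk : IsKahlerTensor k)
    (hA : ∀ α β, conj (A α β) = A β α)
    (hpos : ∀ ξ : Cn n, ξ ≠ 0 → 0 < (hermSum A ξ ξ).re) {σ : ℝ}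
    (hQ : ∀ u v : Cn n, 0 ≤ σ * (tensorForm k u u v v).re) {ξ η : Cn n} (hξ : ξ ≠ 0)
    (hη : η ≠ 0) : ∃ ζ : Cn n, ζ ≠ 0 ∧ σ * bisecQuot k A ξ η ≤ σ * bisecQuot k A ζ ζ := by
  obtain ⟨s, t, hs, ht, h₁, h₂, h₃⟩ := exists_smul_unit_real hA hpos hξ hη
  rw [← hk.bisecQuot_smul hs ht]
  generalize s • ξ = ξ' at *
  generalize t • η = η' at *
  have hplus : hermSum A (ξ' + Complex.I • η') (ξ' + Complex.I • η') = 2 := by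
    simp only [hermSum_add_left, hermSum_add_right, hermSum_smul_left, hermSum_smul_right, h₁, h₂,
      h₃, Complex.conj_I]
    linear_combination -Complex.I_sq
  have hminus : hermSum A (ξ' + (-Complex.I) • η') (ξ' + (-Complex.I) • η') = 2 := by
    simp only [hermSum_add_left, hermSum_add_right, hermSum_smul_left, hermSum_smul_right, h₁, h₂,
      h₃, Complex.conj_I, map_neg]
    linear_combination -Complex.I_sq
  have hne : ∀ ζ : Cn n, hermSum A ζ ζ = 2 → ζ ≠ 0 := by
    rintro ζ h rfl
    simp [hermSum] at h
  have key := congrArg Complex.re (hk.quartic_add_quartic ξ' η')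
  have hq := hQ (ξ' + η') (ξ' + (-1 : ℂ) • η')
  have hb : ∀ ζ : Cn n, hermSum A ζ ζ = 2 →
      bisecQuot k A ζ ζ = (tensorForm k ζ ζ ζ ζ).re / 4 := by
    intro ζ h
    rw [bisecQuot, h, show (2 * 2 : ℂ) = ((4 : ℝ) : ℂ) by norm_num, Complex.div_ofReal_re]
  have hb' : bisecQuot k A ξ' η' = (tensorForm k ξ' ξ' η' η').re := by
    rw [bisecQuot, h₁, h₂]; simp
  simp only [Complex.add_re, Complex.mul_re, Complex.re_ofNat, Complex.im_ofNat, zero_mul,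
    sub_zero] at key
  -- If both `ξ' ± iη'` failed, the sum of their values, which by `key` and `hq` is at least
  -- `2σB(ξ',η')`, would be smaller than that.
  by_contra! hcon
  have c₁ := hcon _ (hne _ hplus)
  have c₂ := hcon _ (hne _ hminus)
  rw [hb _ hplus, hb'] at c₁
  rw [hb _ hminus, hb'] at c₂
  have key' := congrArg (σ * ·) key
  simp only [mul_add] at key'
  linarith

lemma continuousOn_bisecQuot_diag (k : Fin n → Fin n → Fin n → Fin n → ℂ)
    (hpos : ∀ ξ : Cn n, ξ ≠ 0 → 0 < (hermSum A ξ ξ).re) :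
    ContinuousOn (fun ζ : Cn n => bisecQuot k A ζ ζ) {0}ᶜ := by
  unfold bisecQuot
  refine Complex.continuous_re.comp_continuousOn (ContinuousOn.div ?_ ?_ ?_)
  · unfold tensorForm; fun_prop
  · unfold hermSum; fun_prop
  · intro ζ hζ h0
    have h1 := hpos ζ hζ
    rw [mul_self_eq_zero] at h0
    simp [h0] at h1

/-- Scale invariance reduces the diagonal values to the compact unit sphere, where they are
continuous. -/
lemma IsKahlerTensor.exists_forall_bisecQuot_le (hn : 0 < n) (hk : IsKahlerTensor k)
    (hA : ∀ α β, conj (A α β) = A β α)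
    (hpos : ∀ ξ : Cn n, ξ ≠ 0 → 0 < (hermSum A ξ ξ).re) {σ : ℝ}
    (hQ : ∀ u v : Cn n, 0 ≤ σ * (tensorForm k u u v v).re) :
    ∃ ζ : Cn n, ζ ≠ 0 ∧ ∀ ξ η : Cn n, ξ ≠ 0 → η ≠ 0 →
      σ * bisecQuot k A ξ η ≤ σ * bisecQuot k A ζ ζ := by
  have : Nonempty (Fin n) := ⟨⟨0, hn⟩⟩
  have hsub : Metric.sphere (0 : Cn n) 1 ⊆ {0}ᶜ := fun z hz => by
    rintro rfl; simp at hz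
  have hne : (Metric.sphere (0 : Cn n) 1).Nonempty :=
    ⟨cvec ⟨0, hn⟩, by simp [cvec]⟩
  obtain ⟨ζ, hζ, hmax⟩ := (isCompact_sphere (0 : Cn n) 1).exists_isMaxOn hne
    (((continuousOn_bisecQuot_diag k hpos).mono hsub).const_smul σ)
  refine ⟨ζ, hsub hζ, fun ξ η hξ hη => ?_⟩
  obtain ⟨w, hw, hle⟩ := hk.exists_bisecQuot_le hA hpos hQ hξ hη
  refine hle.trans ?_
  have hnw : ((‖w‖ : ℝ) : ℂ)⁻¹ ≠ 0 := by simpa using hw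
  rw [← hk.bisecQuot_smul hnw hnw w w]
  refine hmax ?_
  simp [norm_smul, hw]

end tensorForm

end HermitianGeometry

end

noncomputable section

namespace HermitianGeometry

variable {n : ℕ}

/-! ### Wirtinger derivatives -/

/-- The derivative of type `(1,0)` in the direction `X`. -/
def wirt (X : Cn n) (f : Cn n → ℂ) (z : Cn n) : ℂ :=
  (1 / 2) * (fderiv ℝ f z X - Complex.I * fderiv ℝ f z (Complex.I • X))

/-- The derivative of type `(0,1)` in the direction `X`. -/
def wirtBar (X : Cn n) (f : Cn n → ℂ) (z : Cn n) : ℂ :=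
  (1 / 2) * (fderiv ℝ f z X + Complex.I * fderiv ℝ f z (Complex.I • X))

lemma wirt_add_wirtBar (X : Cn n) (f : Cn n → ℂ) (z : Cn n) :
    wirt X f z + wirtBar X f z = fderiv ℝ f z X := by
  unfold wirt wirtBar; ring

lemma sum_smul_cvec (X : Cn n) : ∑ γ, X γ • cvec γ = X := by
  ext i
  simp [cvec, Finset.sum_apply, Pi.single_apply]

lemma clm_smul (L : Cn n →L[ℝ] ℂ) (a : ℂ) (v : Cn n) :
    L (a • v) = a.re * L v + a.im * L (Complex.I • v) := by
  have : a • v = a.re • v + a.im • Complex.I • v := by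
    rw [← Complex.coe_smul, ← Complex.coe_smul, smul_smul, ← add_smul, Complex.re_add_im]
  rw [this, map_add, map_smul, map_smul, Complex.real_smul, Complex.real_smul]

lemma clm_eq_sum (L : Cn n →L[ℝ] ℂ) (X : Cn n) :
    L X = ∑ γ, ((X γ).re * L (cvec γ) + (X γ).im * L (Complex.I • cvec γ)) := by
  conv_lhs => rw [← sum_smul_cvec X, map_sum]
  exact Finset.sum_congr rfl fun γ _ => clm_smul L _ _

lemma clm_I_smul_eq_sum (L : Cn n →L[ℝ] ℂ) (X : Cn n) :
    L (Complex.I • X)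
      = ∑ γ, (-(X γ).im * L (cvec γ) + (X γ).re * L (Complex.I • cvec γ)) := by
  rw [clm_eq_sum]
  refine Finset.sum_congr rfl fun γ _ => ?_
  simp

/-- For a merely real-linear `L`, the combination `L X - i L(iX)` is complex linear in `X`, so
coordinate directions determine it. Its barred analogue is conjugate linear. -/
lemma wirt_eq_sum (X : Cn n) (f : Cn n → ℂ) (z : Cn n) :
    wirt X f z = ∑ γ, X γ * dz γ f z := by
  rw [wirt, clm_eq_sum, clm_I_smul_eq_sum, Finset.mul_sum, ← Finset.sum_sub_distrib,
    Finset.mul_sum]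
  refine Finset.sum_congr rfl fun γ _ => ?_
  conv_rhs => rw [dz, ← Complex.re_add_im (X γ)]
  linear_combination (-(1 / 2) * ((X γ).im : ℂ) * fderiv ℝ f z (Complex.I • cvec γ)) *
    Complex.I_sq * (-1)

lemma wirtBar_eq_sum (X : Cn n) (f : Cn n → ℂ) (z : Cn n) :
    wirtBar X f z = ∑ γ, conj (X γ) * dzbar γ f z := by
  rw [wirtBar, clm_eq_sum, clm_I_smul_eq_sum, Finset.mul_sum, ← Finset.sum_add_distrib,
    Finset.mul_sum]
  refine Finset.sum_congr rfl fun γ _ => ?_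
  conv_rhs => rw [dzbar, ← Complex.re_add_im (X γ)]
  simp only [map_add, map_mul, Complex.conj_ofReal, Complex.conj_I]
  linear_combination ((1 / 2) * ((X γ).im : ℂ) * fderiv ℝ f z (Complex.I • cvec γ)) *
    Complex.I_sq

section second

variable {f : Cn n → ℂ} {z : Cn n}

lemma fderiv_clm_apply_const (hf : ContDiffAt ℝ 2 f z) (Y : Cn n) :
    HasFDerivAt (fun w => fderiv ℝ f w Y) ((fderiv ℝ (fderiv ℝ f) z).flip Y) z := by
  have h1 : DifferentiableAt ℝ (fderiv ℝ f) z :=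
    (hf.fderiv_right (m := 1) (by norm_num)).differentiableAt (by norm_num)
  have := h1.hasFDerivAt.clm_apply (hasFDerivAt_const Y z)
  rwa [ContinuousLinearMap.comp_zero, zero_add] at this

lemma hasFDerivAt_wirt (hf : ContDiffAt ℝ 2 f z) (Y : Cn n) :
    HasFDerivAt (wirt Y f) ((1 / 2 : ℂ) • ((fderiv ℝ (fderiv ℝ f) z).flip Y
      - Complex.I • (fderiv ℝ (fderiv ℝ f) z).flip (Complex.I • Y))) z :=
  ((fderiv_clm_apply_const hf Y).sub
    ((fderiv_clm_apply_const hf (Complex.I • Y)).const_mul Complex.I)).const_mul _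

lemma hasFDerivAt_wirtBar (hf : ContDiffAt ℝ 2 f z) (Y : Cn n) :
    HasFDerivAt (wirtBar Y f) ((1 / 2 : ℂ) • ((fderiv ℝ (fderiv ℝ f) z).flip Y
      + Complex.I • (fderiv ℝ (fderiv ℝ f) z).flip (Complex.I • Y))) z :=
  ((fderiv_clm_apply_const hf Y).add
    ((fderiv_clm_apply_const hf (Complex.I • Y)).const_mul Complex.I)).const_mul _

lemma snd_fderiv_symm (hf : ContDiffAt ℝ 2 f z) (u v : Cn n) :
    fderiv ℝ (fderiv ℝ f) z u v = fderiv ℝ (fderiv ℝ f) z v u :=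
  (hf.isSymmSndFDerivAt (by simp)).eq u v

lemma wirt_wirt_comm (hf : ContDiffAt ℝ 2 f z) (X Y : Cn n) :
    wirt X (wirt Y f) z = wirt Y (wirt X f) z := by
  rw [wirt, wirt, (hasFDerivAt_wirt hf Y).fderiv, (hasFDerivAt_wirt hf X).fderiv]
  simp only [smul_apply, sub_apply,
    ContinuousLinearMap.flip_apply, smul_eq_mul, snd_fderiv_symm hf X, snd_fderiv_symm hf (_ • X)]
  ring

lemma wirt_wirtBar_comm (hf : ContDiffAt ℝ 2 f z) (X Y : Cn n) :
    wirt X (wirtBar Y f) z = wirtBar Y (wirt X f) z := by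
  rw [wirt, wirtBar, (hasFDerivAt_wirtBar hf Y).fderiv, (hasFDerivAt_wirt hf X).fderiv]
  simp only [smul_apply, sub_apply,
    add_apply,
    ContinuousLinearMap.flip_apply, smul_eq_mul, snd_fderiv_symm hf X, snd_fderiv_symm hf (_ • X)]
  ring

end second

lemma conj_fderiv (f : Cn n → ℂ) (z X : Cn n) :
    conj (fderiv ℝ f z X) = fderiv ℝ (fun w => conj (f w)) z X := by
  have := Complex.conjCLE.comp_fderiv (f := f) (x := z)
  have h2 : (Complex.conjCLE ∘ f) = fun w => conj (f w) := rfl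
  rw [h2] at this
  rw [this]; rfl

lemma conj_wirt (f : Cn n → ℂ) (z X : Cn n) :
    conj (wirt X f z) = wirtBar X (fun w => conj (f w)) z := by
  simp only [wirt, wirtBar, map_mul, map_sub, map_div₀, map_one, Complex.conj_I, conj_fderiv,
    map_ofNat]
  ring

lemma conj_wirtBar (f : Cn n → ℂ) (z X : Cn n) :
    conj (wirtBar X f z) = wirt X (fun w => conj (f w)) z := by
  simp only [wirt, wirtBar, map_mul, map_add, map_div₀, map_one, Complex.conj_I, conj_fderiv,
    map_ofNat]
  ring

/-! ### The curvature of a Hermitian metric in a coordinate domain -/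

section local_metric

variable {G : Cn n → Matrix (Fin n) (Fin n) ℂ} {z : Cn n}

/-- Conjugation exchanges the two types of derivative and transposes both `G` and its inverse; the
second-order term also needs mixed derivatives to commute. -/
lemma conj_chernCurvature (hG : ∀ α β, ContDiffAt ℝ 2 (fun w => G w α β) z)
    (hH : ∀ w α β, conj (G w α β) = G w β α) (α β γ δ : Fin n) :
    conj (chernCurvature G z α β γ δ) = chernCurvature G z β α δ γ := by
  have hdz : ∀ (γ : Fin n) f w, dz γ f w = wirt (cvec γ) f w := fun _ _ _ => rfl
  have hdzb : ∀ (γ : Fin n) f, dzbar γ f = wirtBar (cvec γ) f := fun _ _ => rfl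
  have hinv : ∀ l k, conj ((G z)⁻¹ l k) = (G z)⁻¹ k l := by
    intro l k
    have h1 : (G z).conjTranspose = G z := by
      ext i j; simp [Matrix.conjTranspose_apply, hH]
    have h2 := Matrix.conjTranspose_nonsing_inv (G z)
    rw [h1] at h2
    exact congrFun (congrFun h2 k) l
  simp only [chernCurvature, hdz, hdzb, map_add, map_neg, map_sum, map_mul, conj_wirt,
    conj_wirtBar, hinv, hH]
  congr 1
  · rw [← wirt_wirtBar_comm (hG β α)]
  · rw [Finset.sum_comm]
    refine Finset.sum_congr rfl fun _ _ => Finset.sum_congr rfl fun _ _ => by ring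

/-! ### The connection matrix and the curvature of the induced connection -/

/-- The matrix of derivatives of type `(1,0)` of the metric. -/
def wirtMat (G : Cn n → Matrix (Fin n) (Fin n) ℂ) (X w : Cn n) : Matrix (Fin n) (Fin n) ℂ :=
  Matrix.of fun α β => wirt X (fun w => G w α β) w

/-- The matrix of derivatives of type `(0,1)` of the metric. -/
def wirtBarMat (G : Cn n → Matrix (Fin n) (Fin n) ℂ) (X w : Cn n) : Matrix (Fin n) (Fin n) ℂ :=
  Matrix.of fun α β => wirtBar X (fun w => G w α β) w

/-- The connection matrix `(∂_X G) G⁻¹`. -/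
def connMat (G : Cn n → Matrix (Fin n) (Fin n) ℂ) (X w : Cn n) : Matrix (Fin n) (Fin n) ℂ :=
  wirtMat G X w * (G w)⁻¹

/-- The entrywise real derivative of a matrix-valued function. -/
def derivMat (A : Cn n → Matrix (Fin n) (Fin n) ℂ) (X w : Cn n) : Matrix (Fin n) (Fin n) ℂ :=
  Matrix.of fun α β => fderiv ℝ (fun w => A w α β) w X

lemma sum_chernCoeff (X w : Cn n) (α β : Fin n) :
    ∑ γ, chernCoeff G w α β γ * X γ = connMat G X w β α := by
  simp only [connMat, chernCoeff, Matrix.mul_apply, wirtMat, Matrix.of_apply, wirt_eq_sum,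
    Finset.sum_mul]
  rw [Finset.sum_comm]
  refine Finset.sum_congr rfl fun _ _ => Finset.sum_congr rfl fun _ _ => by ring

lemma inducedConnection_apply (X V : Cn n → Cn n) (w : Cn n) (α : Fin n) :
    inducedConnection G X V w α
      = fderiv ℝ V w (X w) α + ∑ β, V w β * connMat G (X w) w β α := by
  simp only [inducedConnection, PiLp.add_apply, ← sum_chernCoeff, Finset.mul_sum]
  congr 1
  refine Finset.sum_congr rfl fun _ _ => Finset.sum_congr rfl fun _ _ => by ring

lemma inducedConnection_zero (V : Cn n → Cn n) (w : Cn n) :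
    inducedConnection G 0 V w = 0 := by
  ext α
  simp [inducedConnection]

lemma differentiableAt_det {A : Cn n → Matrix (Fin n) (Fin n) ℂ}
    (hA : ∀ α β, DifferentiableAt ℝ (fun w => A w α β) z) :
    DifferentiableAt ℝ (fun w => (A w).det) z := by
  simp only [Matrix.det_apply']
  fun_prop

lemma differentiableAt_inv (hG : ∀ α β, DifferentiableAt ℝ (fun w => G w α β) z)
    (hdet : (G z).det ≠ 0) (α β : Fin n) : DifferentiableAt ℝ (fun w => (G w)⁻¹ α β) z := by
  simp only [Matrix.inv_def, Matrix.smul_apply, Ring.inverse_eq_inv', smul_eq_mul,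
    Matrix.adjugate_apply]
  refine ((differentiableAt_det hG).inv hdet).mul (differentiableAt_det fun i j => ?_)
  simp only [Matrix.updateRow_apply]
  split_ifs
  · fun_prop
  · exact hG i j

lemma differentiableAt_connMat (hG : ∀ α β, ContDiffAt ℝ 2 (fun w => G w α β) z)
    (hdet : (G z).det ≠ 0) (X : Cn n) (α β : Fin n) :
    DifferentiableAt ℝ (fun w => connMat G X w α β) z := by
  simp only [connMat, Matrix.mul_apply]
  refine DifferentiableAt.fun_sum fun k _ => ?_
  exact (hasFDerivAt_wirt (hG α k) X).differentiableAt.mul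
    (differentiableAt_inv (fun α β => (hG α β).differentiableAt (by norm_num)) hdet k β)

lemma derivMat_mul {A B : Cn n → Matrix (Fin n) (Fin n) ℂ}
    (hA : ∀ α β, DifferentiableAt ℝ (fun w => A w α β) z)
    (hB : ∀ α β, DifferentiableAt ℝ (fun w => B w α β) z) (X : Cn n) :
    derivMat (fun w => A w * B w) X z = derivMat A X z * B z + A z * derivMat B X z := by
  ext α β
  simp only [derivMat, Matrix.of_apply, Matrix.mul_apply, Matrix.add_apply]
  rw [fderiv_fun_sum fun k _ => (hA α k).fun_mul (hB k β), sum_apply,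
    ← Finset.sum_add_distrib]
  refine Finset.sum_congr rfl fun k _ => ?_
  rw [fderiv_fun_mul (hA α k) (hB k β)]
  simp only [add_apply, smul_apply, smul_eq_mul]
  ring

lemma connMat_mul (hdet : (G z).det ≠ 0) (X : Cn n) : connMat G X z * G z = wirtMat G X z := by
  rw [connMat, Matrix.mul_assoc, Matrix.nonsing_inv_mul _ (isUnit_iff_ne_zero.2 hdet),
    Matrix.mul_one]

/-- This is the Leibniz rule for `θ_Y G = ∂_Y G`, with `θ` the connection matrix. It yields the
derivative of `θ_Y` without a formula for that of `G⁻¹`. -/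
lemma derivMat_connMat_mul (hG : ∀ α β, ContDiffAt ℝ 2 (fun w => G w α β) z)
    (hdet : (G z).det ≠ 0) (X Y : Cn n) :
    derivMat (connMat G Y) X z * G z + connMat G Y z * derivMat G X z
      = derivMat (wirtMat G Y) X z := by
  have hG' : ∀ α β, DifferentiableAt ℝ (fun w => G w α β) z :=
    fun α β => (hG α β).differentiableAt (by norm_num)
  rw [← derivMat_mul (differentiableAt_connMat hG hdet Y) hG']
  ext α β
  simp only [derivMat, Matrix.of_apply]
  congr 1
  refine Filter.EventuallyEq.fderiv_eq ?_
  -- The factorization needs an invertible `G w`, which persists near `z`; a derivative requires no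
  -- more.
  have hc : ContinuousAt (fun w => (G w).det) z := (differentiableAt_det hG').continuousAt
  filter_upwards [hc.eventually_ne hdet] with w hw
  rw [connMat_mul hw]

/-- The contraction of the curvature tensor in its third slot with `Y` and in its fourth slot with
`X̄`. -/
def curvMat (G : Cn n → Matrix (Fin n) (Fin n) ℂ) (Y X z : Cn n) : Matrix (Fin n) (Fin n) ℂ :=
  Matrix.of fun β μ => ∑ γ, ∑ δ, chernCurvature G z β μ γ δ * Y γ * conj (X δ)

lemma curvMat_eq (hG : ∀ α β, ContDiffAt ℝ 2 (fun w => G w α β) z) (Y X : Cn n) (β μ : Fin n) :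
    curvMat G Y X z β μ
      = (connMat G Y z * wirtBarMat G X z) β μ - wirtBar X (wirt Y fun w => G w β μ) z := by
  have h1 : wirtBar X (wirt Y fun w => G w β μ) z
      = ∑ γ, ∑ δ, Y γ * conj (X δ) * dz γ (dzbar δ fun w => G w β μ) z := by
    have h2 : ∀ γ, dzbar γ (wirt Y fun w => G w β μ) z
        = ∑ δ, Y δ * dz δ (dzbar γ fun w => G w β μ) z := by
      intro γ
      rw [← wirt_eq_sum]
      exact (wirt_wirtBar_comm (hG β μ) Y (cvec γ)).symm
    simp only [wirtBar_eq_sum X, h2, Finset.mul_sum]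
    rw [Finset.sum_comm]
    refine Finset.sum_congr rfl fun _ _ => Finset.sum_congr rfl fun _ _ => by ring
  have h3 : (connMat G Y z * wirtBarMat G X z) β μ
      = ∑ γ, ∑ δ, (∑ l, ∑ k, dz γ (fun w => G w β l) z * (G z)⁻¹ l k
          * dzbar δ (fun w => G w k μ) z) * Y γ * conj (X δ) := by
    simp only [connMat, wirtMat, wirtBarMat, Matrix.mul_apply, Matrix.of_apply, wirt_eq_sum,
      wirtBar_eq_sum, Finset.mul_sum, Finset.sum_mul]
    calc _ = ∑ k, ∑ δ, ∑ γ, ∑ l, Y γ * dz γ (fun w => G w β l) z * (G z)⁻¹ l k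
          * (conj (X δ) * dzbar δ (fun w => G w k μ) z) :=
          Finset.sum_congr rfl fun _ _ => Finset.sum_congr rfl fun _ _ => Finset.sum_comm
      _ = ∑ γ, ∑ δ, ∑ k, ∑ l, Y γ * dz γ (fun w => G w β l) z * (G z)⁻¹ l k
          * (conj (X δ) * dzbar δ (fun w => G w k μ) z) := by
          rw [Finset.sum_comm]
          rw [Finset.sum_comm (s := (Finset.univ : Finset (Fin n))) (γ := Fin n)
            (f := fun γ δ => ∑ k, ∑ l, Y γ * dz γ (fun w => G w β l) z * (G z)⁻¹ l k
              * (conj (X δ) * dzbar δ (fun w => G w k μ) z))]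
          exact Finset.sum_congr rfl fun _ _ => Finset.sum_comm
      _ = _ := by
          refine Finset.sum_congr rfl fun _ _ => Finset.sum_congr rfl fun _ _ => ?_
          rw [Finset.sum_comm]
          refine Finset.sum_congr rfl fun _ _ => Finset.sum_congr rfl fun _ _ => by ring
  rw [h1, h3, curvMat, Matrix.of_apply, ← Finset.sum_sub_distrib]
  refine Finset.sum_congr rfl fun _ _ => ?_
  rw [← Finset.sum_sub_distrib]
  refine Finset.sum_congr rfl fun _ _ => ?_
  rw [chernCurvature]
  ring

/-- Split the derivative of `G` along `X` into `∂_X G = θ_X G` and `∂̄_X G`. The first part absorbs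
`θ_Y θ_X G`; the second combines with `∂̄_X ∂_Y G` into minus the curvature. What remains, `∂_X ∂_Y
G`, is symmetric in `X` and `Y`. -/
lemma derivMat_connMat_add (hG : ∀ α β, ContDiffAt ℝ 2 (fun w => G w α β) z)
    (hdet : (G z).det ≠ 0) (X Y : Cn n) :
    (derivMat (connMat G Y) X z + connMat G Y z * connMat G X z) * G z
      = Matrix.of (fun β μ => wirt X (wirt Y fun w => G w β μ) z) - curvMat G Y X z := by
  have hd : derivMat G X z = wirtMat G X z + wirtBarMat G X z := by
    ext α β
    simp [derivMat, wirtMat, wirtBarMat, wirt_add_wirtBar]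
  have h1 := derivMat_connMat_mul hG hdet X Y
  rw [hd, Matrix.mul_add, ← connMat_mul hdet X, ← Matrix.mul_assoc, ← add_assoc,
    ← Matrix.add_mul] at h1
  rw [eq_sub_of_add_eq h1]
  ext β μ
  rw [Matrix.sub_apply, Matrix.sub_apply, curvMat_eq hG, Matrix.of_apply]
  have := wirt_add_wirtBar X (wirt Y fun w => G w β μ) z
  have h2 : derivMat (wirtMat G Y) X z β μ = fderiv ℝ (wirt Y fun w => G w β μ) z X := rfl
  rw [h2, ← this]
  ring

lemma inducedConnection_inducedConnection_const
    (hG : ∀ α β, ContDiffAt ℝ 2 (fun w => G w α β) z) (hdet : (G z).det ≠ 0) (X Y V : Cn n)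
    (α : Fin n) :
    inducedConnection G (fun _ => X) (inducedConnection G (fun _ => Y) fun _ => V) z α
      = ∑ β, V β * (derivMat (connMat G Y) X z + connMat G Y z * connMat G X z) β α := by
  have h0 : ∀ w α, inducedConnection G (fun _ => Y) (fun _ => V) w α
      = ∑ β, V β * connMat G Y w β α := by
    intro w α
    rw [inducedConnection_apply]
    simp
  have hdiff : ∀ α, DifferentiableAt ℝ
      (fun w => inducedConnection G (fun _ => Y) (fun _ => V) w α) z := by
    intro α
    simp only [h0]
    exact DifferentiableAt.fun_sum fun β _ => (differentiableAt_connMat hG hdet Y β α).const_mul _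
  have hdiff' : DifferentiableAt ℝ (inducedConnection G (fun _ => Y) fun _ => V) z :=
    (differentiableAt_piLp 2).2 hdiff
  have hcomp : fderiv ℝ (inducedConnection G (fun _ => Y) fun _ => V) z X α
      = fderiv ℝ (fun w => inducedConnection G (fun _ => Y) (fun _ => V) w α) z X := by
    have := ((PiLp.proj 2 (𝕜 := ℝ) (fun _ : Fin n => ℂ) α).hasFDerivAt.comp z
      hdiff'.hasFDerivAt).fderiv
    exact (congrArg (fun L => L X) this).symm
  rw [inducedConnection_apply, hcomp]
  simp only [h0]
  rw [fderiv_fun_sum fun β _ => (differentiableAt_connMat hG hdet Y β α).const_mul _,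
    sum_apply]
  simp only [Matrix.add_apply, mul_add, Finset.sum_add_distrib]
  congr 1
  · refine Finset.sum_congr rfl fun β _ => ?_
    rw [fderiv_const_mul (differentiableAt_connMat hG hdet Y β α)]
    rfl
  · simp only [Matrix.mul_apply, Finset.sum_mul, Finset.mul_sum]
    rw [Finset.sum_comm]
    refine Finset.sum_congr rfl fun _ _ => Finset.sum_congr rfl fun _ _ => by ring

/-- The metric contraction of the curvature of the induced connection, in terms of the Chern
curvature tensor. -/
lemma hermSum_inducedCurvature (hG : ∀ α β, ContDiffAt ℝ 2 (fun w => G w α β) z)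
    (hdet : (G z).det ≠ 0) (X Y V W : Cn n) :
    hermSum (G z) (inducedCurvature G (fun _ => X) (fun _ => Y) (fun _ => V) z) W
      = tensorForm (chernCurvature G z) V W X Y - tensorForm (chernCurvature G z) V W Y X := by
  have hbr : VectorField.lieBracket ℝ (fun _ : Cn n => X) (fun _ => Y) = 0 := by
    ext w
    simp [VectorField.lieBracket_eq]
  have hT : ∀ X Y, tensorForm (chernCurvature G z) V W X Y
      = ∑ β, ∑ μ, V β * curvMat G X Y z β μ * conj (W μ) := by
    intro X Y
    simp only [tensorForm, curvMat, Matrix.of_apply, Finset.mul_sum, Finset.sum_mul]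
    refine Finset.sum_congr rfl fun _ _ => Finset.sum_congr rfl fun _ _ =>
      Finset.sum_congr rfl fun _ _ => Finset.sum_congr rfl fun _ _ => by ring
  set S : Matrix (Fin n) (Fin n) ℂ :=
    (derivMat (connMat G Y) X z + connMat G Y z * connMat G X z)
      - (derivMat (connMat G X) Y z + connMat G X z * connMat G Y z) with hS
  have hcurv : ∀ α, inducedCurvature G (fun _ => X) (fun _ => Y) (fun _ => V) z α
      = ∑ β, V β * S β α := by
    intro α
    rw [inducedCurvature, hbr, inducedConnection_zero, sub_zero, PiLp.sub_apply,
      inducedConnection_inducedConnection_const hG hdet,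
      inducedConnection_inducedConnection_const hG hdet, ← Finset.sum_sub_distrib]
    refine Finset.sum_congr rfl fun _ _ => ?_
    rw [hS, Matrix.sub_apply, mul_sub]
  have hSG : S * G z = curvMat G X Y z - curvMat G Y X z := by
    rw [hS, Matrix.sub_mul, derivMat_connMat_add hG hdet, derivMat_connMat_add hG hdet]
    -- The pure second derivatives are symmetric, so antisymmetrization removes them.
    have : (Matrix.of fun β μ => wirt X (wirt Y fun w => G w β μ) z)
        = Matrix.of fun β μ => wirt Y (wirt X fun w => G w β μ) z := by
      ext β μ
      exact wirt_wirt_comm (hG β μ) X Y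
    rw [this]
    abel
  rw [hT, hT, ← Finset.sum_sub_distrib]
  have : ∀ β μ, V β * curvMat G X Y z β μ * conj (W μ) - V β * curvMat G Y X z β μ * conj (W μ)
      = ∑ α, V β * S β α * G z α μ * conj (W μ) := by
    intro β μ
    rw [← sub_mul, ← mul_sub, ← Matrix.sub_apply, ← hSG, Matrix.mul_apply, Finset.mul_sum,
      Finset.sum_mul]
    exact Finset.sum_congr rfl fun _ _ => by ring
  simp only [← Finset.sum_sub_distrib, this, hermSum, hcurv, Finset.mul_sum, Finset.sum_mul]
  calc _ = ∑ α, ∑ β, ∑ μ, G z α μ * (V β * S β α) * conj (W μ) :=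
        Finset.sum_congr rfl fun _ _ => Finset.sum_comm
    _ = ∑ β, ∑ μ, ∑ α, G z α μ * (V β * S β α) * conj (W μ) := by
        rw [Finset.sum_comm]
        exact Finset.sum_congr rfl fun _ _ => Finset.sum_comm
    _ = _ := by
        refine Finset.sum_congr rfl fun _ _ => Finset.sum_congr rfl fun _ _ =>
          Finset.sum_congr rfl fun _ _ => by ring

end local_metric

end HermitianGeometry

end

noncomputable section

namespace HermitianGeometry

variable {n : ℕ}

/-! ### Pointwise data of a Hermitian manifold -/

variable {M : Type*} [TopologicalSpace M] [ChartedSpace (Cn n) M]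
  [IsManifold 𝓘(ℂ, Cn n) 1 M]

namespace HermitianMetric

variable (h : HermitianMetric n M)

/-- The point recovered from its own coordinates equals `p` only propositionally, while the tangent
space depends on it. A free `q` allows substitution. -/
lemma form_frame_eq (p q : M) (hq : q = p) (α β : Fin n) :
    h.form q (tangentCoordChange 𝓘(ℂ, Cn n) p q q (cvec α) : Cn n)
      (tangentCoordChange 𝓘(ℂ, Cn n) p q q (cvec β) : Cn n)
      = h.form p (cvec α : Cn n) (cvec β : Cn n) := by
  subst hq
  rw [tangentCoordChange_self (mem_extChartAt_source _),
    tangentCoordChange_self (mem_extChartAt_source _)]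

/-- The matrix of the metric at `p` in the preferred chart. -/
def matAt (p : M) : Matrix (Fin n) (Fin n) ℂ := h.comp p (extChartAt 𝓘(ℂ, Cn n) p p)

lemma matAt_apply (p : M) (α β : Fin n) :
    h.matAt p α β = h.form p (cvec α : Cn n) (cvec β : Cn n) :=
  h.form_frame_eq p _ (extChartAt_to_inv p) α β

lemma form_eq_hermSum (p : M) (ξ η : Cn n) : h.form p ξ η = hermSum (h.matAt p) ξ η := by
  let L : Cn n →ₗ[ℂ] Cn n →ₗ⋆[ℂ] ℂ := h.form p
  have hL : L ξ η = hermSum (h.matAt p) ξ η := by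
    conv_lhs => rw [← sum_smul_cvec ξ, ← sum_smul_cvec η]
    simp only [map_sum, LinearMap.sum_apply, map_smul, LinearMap.smul_apply, map_smulₛₗ,
      smul_eq_mul, hermSum, matAt_apply]
    simp only [Finset.mul_sum]
    rw [Finset.sum_comm]
    refine Finset.sum_congr rfl fun α _ => Finset.sum_congr rfl fun β _ => ?_
    change _ = L (cvec α) (cvec β) * _ * _
    ring
  exact hL

lemma conj_comp (p : M) (z : Cn n) (α β : Fin n) : conj (h.comp p z α β) = h.comp p z β α :=
  h.conj_symm _ _ _

lemma conj_matAt (p : M) (α β : Fin n) : conj (h.matAt p α β) = h.matAt p β α :=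
  h.conj_comp p _ α β

lemma contDiffAt_comp (p : M) (α β : Fin n) :
    ContDiffAt ℝ 2 (fun w => h.comp p w α β) (extChartAt 𝓘(ℂ, Cn n) p p) :=
  ((h.smooth p α β).contDiffAt (extChartAt_target_mem_nhds p)).of_le (WithTop.coe_le_coe.2 le_top)

lemma hermSum_matAt_pos (p : M) (ξ : Cn n) (hξ : ξ ≠ 0) : 0 < (hermSum (h.matAt p) ξ ξ).re := by
  rw [← form_eq_hermSum]
  exact h.pos p ξ hξ

lemma det_matAt_ne_zero (p : M) : (h.matAt p).det ≠ 0 := by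
  intro h0
  obtain ⟨v, hv, hv0⟩ := Matrix.exists_vecMul_eq_zero_iff.2 h0
  have hne : WithLp.toLp 2 v ≠ (0 : Cn n) := by simpa using hv
  have hpos := h.hermSum_matAt_pos p _ hne
  have : hermSum (h.matAt p) (WithLp.toLp 2 v) (WithLp.toLp 2 v) = 0 := by
    unfold hermSum
    rw [Finset.sum_comm]
    refine Finset.sum_eq_zero fun β _ => ?_
    have := congrFun hv0 β
    simp only [Matrix.vecMul, dotProduct, Pi.zero_apply] at this
    rw [← Finset.sum_mul, show ∑ i, h.matAt p i β * v i = ∑ i, v i * h.matAt p i β from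
      Finset.sum_congr rfl fun _ _ => mul_comm _ _, this, zero_mul]
  simp [this] at hpos

variable {h} in
lemma IsKahlerLike.isKahlerTensor (hKL : h.IsKahlerLike) (p : M) :
    IsKahlerTensor (h.curv p) :=
  ⟨hKL p, conj_chernCurvature (h.contDiffAt_comp p) (h.conj_comp p)⟩

lemma bisectional_eq (p : M) (ξ η : Cn n) :
    h.bisectional p ξ η = bisecQuot (h.curv p) (h.matAt p) ξ η := by
  unfold bisectional bisecQuot
  rw [form_eq_hermSum, form_eq_hermSum]
  rfl

lemma g_curvatureD (p : M) (u v : Cn n) :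
    h.g p (h.curvatureD p v u u) v
      = (tensorForm (h.curv p) u v v u).re - (tensorForm (h.curv p) u v u v).re := by
  rw [← Complex.sub_re]
  exact congrArg Complex.re ((h.form_eq_hermSum p _ _).trans
    (hermSum_inducedCurvature (h.contDiffAt_comp p) (h.det_matAt_ne_zero p) v u u v))

lemma g_add_smul (p : M) (u v : Cn n) (a b : ℝ) :
    (hermSum (h.matAt p) ((a : ℂ) • u + (b : ℂ) • v) ((a : ℂ) • u + (b : ℂ) • v)).re
      = a ^ 2 * h.g p u u + 2 * a * b * h.g p u v + b ^ 2 * h.g p v v := by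
  unfold g
  simp only [form_eq_hermSum]
  have hc : (hermSum (h.matAt p) v u).re = (hermSum (h.matAt p) u v).re := by
    rw [← conj_hermSum (h.conj_matAt p), Complex.conj_re]
  simp only [hermSum_add_left, hermSum_add_right, hermSum_smul_left, hermSum_smul_right,
    Complex.conj_ofReal, Complex.add_re, Complex.re_ofReal_mul, hc]
  ring

lemma gram_pos (p : M) (u v : Cn n) (huv : LinearIndependent ℝ ![u, v]) :
    0 < h.g p u u * h.g p v v - h.g p u v ^ 2 := by
  have hu : u ≠ 0 := huv.ne_zero 0
  have hpu : 0 < h.g p u u := h.pos p u hu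
  -- This is `g(u,u)` times the component of `v` orthogonal to `u`; its squared norm is `g(u,u)`
  -- times the Gram determinant.
  set w : Cn n := ((-h.g p u v : ℝ) : ℂ) • u + ((h.g p u u : ℝ) : ℂ) • v with hw
  have hw0 : w ≠ 0 := by
    intro h0
    have := LinearIndependent.pair_iff.1 huv (-h.g p u v) (h.g p u u) (by
      rw [← h0, hw, Complex.coe_smul, Complex.coe_smul])
    exact hpu.ne' this.2
  have hpos := h.hermSum_matAt_pos p w hw0
  rw [hw, g_add_smul] at hpos
  have : 0 < h.g p u u * (h.g p u u * h.g p v v - h.g p u v ^ 2) := by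
    convert hpos using 1
    ring
  exact pos_of_mul_pos_right this hpu.le

variable {h}

/-- A sign of the Chern sectional curvature is inherited by the biquadratic form of the
bisectional curvature. -/
lemma IsKahlerLike.tensorForm_sign (hKL : h.IsKahlerLike) (p : M) {σ : ℝ}
    (hσ : ∀ u v : Cn n, LinearIndependent ℝ ![u, v] → 0 ≤ σ * h.chernSectional p u v)
    (u v : Cn n) : 0 ≤ σ * (tensorForm (h.curv p) u u v v).re := by
  have hk := hKL.isKahlerTensor p
  by_cases hu : u = 0
  · subst hu
    simp [tensorForm]
  -- The inequality is needed for every `v`, since `iv` may be a real multiple of `u` even when `v`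
  -- is not. In that dependent case the two terms cancel.
  have hN : ∀ v, 0 ≤ σ * ((tensorForm (h.curv p) u u v v).re
      - (tensorForm (h.curv p) u v u v).re) := by
    intro v
    have hs : tensorForm (h.curv p) u u v v = tensorForm (h.curv p) u v v u :=
      hk.tensorForm_swap' _ _ _ _
    rw [hs, ← h.g_curvatureD]
    by_cases huv : LinearIndependent ℝ ![u, v]
    · have hg := h.gram_pos p u v huv
      have h0 : 0 ≤ σ * (h.g p (h.curvatureD p v u u) v
        / (h.g p u u * h.g p v v - h.g p u v ^ 2)) := hσ u v huv
      have := mul_nonneg h0 hg.le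
      rwa [mul_assoc, div_mul_cancel₀ _ hg.ne'] at this
    · rw [LinearIndependent.pair_iff' hu] at huv
      push Not at huv
      obtain ⟨t, rfl⟩ := huv
      rw [g_curvatureD, ← Complex.coe_smul, tensorForm_smul₂, hk.tensorForm_smul₃,
        tensorForm_smul₂, hk.tensorForm_smul₄]
      simp
  have h₁ := hN v
  -- In `𝔎(u,v̄,u,v̄)` the factor is `(-i)² = -1`, whereas in `Q(u,v)` it is `i(-i) = 1`.
  have h₂ := hN (Complex.I • v)
  rw [hk.tensorForm_smul₃, hk.tensorForm_smul₄, tensorForm_smul₂, hk.tensorForm_smul₄,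
    Complex.conj_I, ← mul_assoc, ← mul_assoc] at h₂
  simp only [mul_neg, neg_mul, neg_neg, Complex.I_mul_I, one_mul, Complex.neg_re] at h₂
  linarith

lemma IsKahlerLike.exists_forall_bisectional_le (hn : 0 < n) (hKL : h.IsKahlerLike) (p : M)
    {σ : ℝ}
    (hσ : ∀ u v : Tan (n := n) p, LinearIndependent ℝ ![u, v] → 0 ≤ σ * h.chernSectional p u v) :
    ∃ ζ : Tan (n := n) p, ζ ≠ 0 ∧ ∀ ξ η : Tan (n := n) p, ξ ≠ 0 → η ≠ 0 →
      σ * h.bisectional p ξ η ≤ σ * h.holomorphicSectional p ζ := by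
  obtain ⟨ζ, hζ, hmax⟩ := (hKL.isKahlerTensor p).exists_forall_bisecQuot_le hn
    (h.conj_matAt p) (h.hermSum_matAt_pos p) (hKL.tensorForm_sign p hσ)
  refine ⟨ζ, hζ, fun ξ η hξ hη => ?_⟩
  simp only [← bisectional_eq] at hmax
  exact hmax ξ η hξ hη

end HermitianMetric

end HermitianGeometry

end

/-! ### From pointwise extrema to extrema over the manifold -/

theorem theorem1p4 {n : ℕ} (hn : 0 < n) {M : Type*} [TopologicalSpace M] [T2Space M]
    [ChartedSpace (HermitianGeometry.Cn n) M]
    [IsManifold 𝓘(ℂ, HermitianGeometry.Cn n) 1 M]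
    (h : HermitianGeometry.HermitianMetric n M) (hKL : h.IsKahlerLike) :
    ((∀ (p : M) (u v : HermitianGeometry.Tan (n := n) p),
        LinearIndependent ℝ ![u, v] → 0 ≤ h.chernSectional p u v) →
      (∀ p : M, ∃ ζ : HermitianGeometry.Tan (n := n) p, ζ ≠ 0 ∧
        ∀ ξ η : HermitianGeometry.Tan (n := n) p, ξ ≠ 0 → η ≠ 0 →
          h.bisectional p ξ η ≤ h.holomorphicSectional p ζ) ∧
      (∀ C : ℝ,
        IsGreatest {r | ∃ (p : M) (ζ : HermitianGeometry.Tan (n := n) p), ζ ≠ 0 ∧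
          r = h.holomorphicSectional p ζ} C ↔
        IsGreatest {r | ∃ (p : M) (ξ η : HermitianGeometry.Tan (n := n) p), ξ ≠ 0 ∧ η ≠ 0 ∧
          r = h.bisectional p ξ η} C)) ∧
    ((∀ (p : M) (u v : HermitianGeometry.Tan (n := n) p),
        LinearIndependent ℝ ![u, v] → h.chernSectional p u v ≤ 0) →
      (∀ p : M, ∃ ζ : HermitianGeometry.Tan (n := n) p, ζ ≠ 0 ∧
        ∀ ξ η : HermitianGeometry.Tan (n := n) p, ξ ≠ 0 → η ≠ 0 →
          h.holomorphicSectional p ζ ≤ h.bisectional p ξ η) ∧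
      (∀ C : ℝ,
        IsLeast {r | ∃ (p : M) (ζ : HermitianGeometry.Tan (n := n) p), ζ ≠ 0 ∧
          r = h.holomorphicSectional p ζ} C ↔
        IsLeast {r | ∃ (p : M) (ξ η : HermitianGeometry.Tan (n := n) p), ξ ≠ 0 ∧ η ≠ 0 ∧
          r = h.bisectional p ξ η} C)) := by
  refine ⟨fun hK => ?_, fun hK => ?_⟩
  · have hmax : ∀ p : M, ∃ ζ : HermitianGeometry.Tan (n := n) p, ζ ≠ 0 ∧
        ∀ ξ η : HermitianGeometry.Tan (n := n) p, ξ ≠ 0 → η ≠ 0 →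
          h.bisectional p ξ η ≤ h.holomorphicSectional p ζ := by
      intro p
      simpa only [one_mul] using hKL.exists_forall_bisectional_le hn p (σ := 1)
        fun u v huv => by simpa only [one_mul] using hK p u v huv
    -- Values of `H` are values of `B` on the diagonal, and each value of `B` lies below a value of
    -- `H` at the same point. The two sets thus have the same upper bounds, and attainment passes
    -- between them.
    refine ⟨hmax, fun C => ⟨?_, ?_⟩⟩
    · rintro ⟨⟨p, ζ, hζ, rfl⟩, hub⟩
      refine ⟨⟨p, ζ, ζ, hζ, hζ, rfl⟩, ?_⟩
      rintro _ ⟨q, ξ, η, hξ, hη, rfl⟩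
      obtain ⟨w, hw, hle⟩ := hmax q
      exact (hle ξ η hξ hη).trans (hub ⟨q, w, hw, rfl⟩)
    · rintro ⟨⟨p, ξ, η, hξ, hη, rfl⟩, hub⟩
      obtain ⟨w, hw, hle⟩ := hmax p
      refine ⟨⟨p, w, hw, le_antisymm (hle ξ η hξ hη) (hub ⟨p, w, w, hw, hw, rfl⟩)⟩, ?_⟩
      rintro _ ⟨q, ζ, hζ, rfl⟩
      exact hub ⟨q, ζ, ζ, hζ, hζ, rfl⟩
  · have hmin : ∀ p : M, ∃ ζ : HermitianGeometry.Tan (n := n) p, ζ ≠ 0 ∧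
        ∀ ξ η : HermitianGeometry.Tan (n := n) p, ξ ≠ 0 → η ≠ 0 →
          h.holomorphicSectional p ζ ≤ h.bisectional p ξ η := by
      intro p
      -- With `σ = -1` the maximum of `-B` becomes the minimum of `B`.
      simpa only [neg_mul, one_mul, neg_le_neg_iff] using
        hKL.exists_forall_bisectional_le hn p (σ := -1)
          fun u v huv => by simpa only [neg_mul, one_mul, neg_nonneg] using hK p u v huv
    refine ⟨hmin, fun C => ⟨?_, ?_⟩⟩
    · rintro ⟨⟨p, ζ, hζ, rfl⟩, hlb⟩
      refine ⟨⟨p, ζ, ζ, hζ, hζ, rfl⟩, ?_⟩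
      rintro _ ⟨q, ξ, η, hξ, hη, rfl⟩
      obtain ⟨w, hw, hle⟩ := hmin q
      exact (hlb ⟨q, w, hw, rfl⟩).trans (hle ξ η hξ hη)
    · rintro ⟨⟨p, ξ, η, hξ, hη, rfl⟩, hlb⟩
      obtain ⟨w, hw, hle⟩ := hmin p
      refine ⟨⟨p, w, hw, le_antisymm (hlb ⟨p, w, w, hw, hw, rfl⟩) (hle ξ η hξ hη)⟩, ?_⟩
      rintro _ ⟨q, ζ, hζ, rfl⟩
      exact hlb ⟨q, ζ, ζ, hζ, hζ, rfl⟩
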